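/- **Setting.** Let $(K^7,\eta,\xi,J,\Omega)$ be a non-empty contact Calabi--Yau $7$-manifold: $\eta$ is a contact form with Reeb field $\xi$; $J$ is an endomorphism of $TK$ with $J\xi=0$, $J^2=-\mathrm{id}+\eta\otimes\xi$, such that $(\eta,\xi,J)$ with $\omega=d\eta$ and transverse Kähler metric $g_V=\omega(\cdot,J\cdot)$ is a Sasakian structure; and $\Omega$ is a closed, horizontal complex $3$-form of type $(3,0)$ with respect to $J$, normalised by $\frac{\omega^3}{3!}=\frac14\,\mathrm{Re}\,\Omega\wedge\mathrm{Im}\,\Omega$. For $\varepsilon>0$ let $g_\varepsilon=\varepsilon^2\eta\otimes\eta+g_V$. Locally choose a $g_\varepsilon$-orthonormal coframe $e_0=\varepsilon\eta,\ e=(e_1,e_2,e_3)^{\rm T},\ Je=(Je_1,Je_2,Je_3)^{\rm T}$ with $$\omega=\sum_{j=1}^3 e_j\wedge Je_j,\qquad \Omega=(e_1+iJe_1)\wedge(e_2+iJe_2)\wedge(e_3+iJe_3).$$ For $a=(a_1,a_2,a_3)^{\rm T}$ put $[a]=\begin{pmatrix}0&a_3&-a_2\\-a_3&0&a_1\\a_2&-a_1&0\end{pmatrix}$,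 and let $$B=\begin{pmatrix}0&Je^{\rm T}&-e^{\rm T}\\-Je&0&-e_0I\\e&e_0I&0\end{pmatrix},\quad C=\begin{pmatrix}0&Je^{\rm T}&-e^{\rm T}\\-Je&-[e]&e_0I+[Je]\\e&-e_0I+[Je]&[e]\end{pmatrix},\quad \mathcal I=\begin{pmatrix}0&0&0\\0&0&-I\\0&I&0\end{pmatrix}.$$ (Invariantly, $g_\varepsilon(C(X)Y,Z)=\varepsilon^{-1}H_\varepsilon(X,Y,Z)$ with $H_\varepsilon=-\varepsilon^2\eta\wedge\omega+\varepsilon\,\mathrm{Re}\,\Omega$.) Let $A$ be the connection on $TK=\mathbb R\xi\oplus\ker\eta$ which is trivial on $\mathbb R\xi$ (i.e. $A\xi=0$) and on $\ker\eta$ is the pull-back of the Levi-Civita connection of the transverse metric $g_V$. For $k\in\mathbb R\setminus\{0\}$ and $\delta,m\in\mathbb R$ define a connection on $TK$ by $$\theta^{\delta,k}_{\varepsilon,m}=A+\frac{k\varepsilon}{2}B+\frac{k\varepsilon\delta}{2}C+\frac{km\varepsilon}{2}\,e_0\,\mathcal I .$$ **Corollary (totally skew-symmetric torsion criterion).** For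 all $\varepsilon>0$, $k\neq0$ and $\delta,m\in\mathbb R$, the connection $\theta^{\delta,k}_{\varepsilon,m}$ has totally skew-symmetric torsion with respect to $g_\varepsilon$ (that is, $(X,Y,Z)\mapsto g_\varepsilon(T(X,Y),Z)$ is totally skew-symmetric, where $T$ is its torsion tensor) if and only if $$1-k\Bigl(1+\frac m2\Bigr)=0 .$$ -/

import Mathlib

open scoped Manifold

set_option linter.unusedSectionVars false

noncomputable section

namespace ContactCY

/-! ## Preliminaries on `7`-manifolds -/

/-- The model space of a `7`-manifold. -/
abbrev E7 : Type := EuclideanSpace ℝ (Fin 7)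

/-- The tangent space `T_x K` of a `7`-manifold. -/
abbrev T {K : Type*} [TopologicalSpace K] [ChartedSpace E7 K] (x : K) : Type :=
  TangentSpace (𝓡 7) x

instance {K : Type*} [TopologicalSpace K] [ChartedSpace E7 K] (x : K) :
    FiniteDimensional ℝ (TangentSpace (𝓡 7) x) :=
  inferInstanceAs (FiniteDimensional ℝ E7)

instance {K : Type*} [TopologicalSpace K] [ChartedSpace E7 K] (x : K) :
    T2Space (TangentSpace (𝓡 7) x) :=
  inferInstanceAs (T2Space E7)

/-- The vector field `X` is differentiable at `x`. -/
abbrev DiffFieldAt {K : Type*} [TopologicalSpace K] [ChartedSpace E7 K]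
    [IsManifold (𝓡 7) (⊤ : ℕ∞) K] (X : ∀ y : K, T y) (x : K) : Prop :=
  MDifferentiableAt (𝓡 7) ((𝓡 7).prod 𝓘(ℝ, E7))
    (fun y ↦ Bundle.TotalSpace.mk' E7 (E := (TangentSpace (𝓡 7) : K → Type _)) y (X y)) x

/-- The vector field `X` is `C^∞` at `x`. -/
abbrev SmoothFieldAt {K : Type*} [TopologicalSpace K] [ChartedSpace E7 K]
    [IsManifold (𝓡 7) (⊤ : ℕ∞) K] (X : ∀ y : K, T y) (x : K) : Prop :=
  ContMDiffAt (𝓡 7) ((𝓡 7).prod 𝓘(ℝ, E7)) (⊤ : ℕ∞)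
    (fun y ↦ Bundle.TotalSpace.mk' E7 (E := (TangentSpace (𝓡 7) : K → Type _)) y (X y)) x

/-- The derivative `X(f)` at `x` of a function `f` along a vector field `X`. -/
def dirDeriv {K F : Type*} [TopologicalSpace K] [ChartedSpace E7 K]
    [NormedAddCommGroup F] [NormedSpace ℝ F]
    (X : ∀ y : K, T y) (f : K → F) (x : K) : F :=
  mvfderiv (𝓡 7) f x (X x)

/-- The Lie bracket `[X, Y]` of vector fields. -/
abbrev bracket {K : Type*} [TopologicalSpace K] [ChartedSpace E7 K]
    (X Y : ∀ y : K, T y) (x : K) : T x :=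
  VectorField.mlieBracket (𝓡 7) X Y x

/-- The wedge product of a `p`-form and a `q`-form on a vector space, as functions of tuples of
vectors, normalised so that `α ∧ β (v, w) = α v * β w - α w * β v` for `1`-forms. -/
def wedge {V : Type*} {p q : ℕ} (α : (Fin p → V) → ℝ) (β : (Fin q → V) → ℝ) :
    (Fin (p + q) → V) → ℝ := fun v ↦
  ((p.factorial : ℝ) * (q.factorial : ℝ))⁻¹ *
    ∑ s : Equiv.Perm (Fin (p + q)), ((Equiv.Perm.sign s : ℤ) : ℝ) *
      (α (fun i ↦ v (s (Fin.castAdd q i))) * β (fun j ↦ v (s (Fin.natAdd p j))))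

/-- `dη = ω`, for a `1`-form `η` and a `2`-form `ω`. -/
def IsExteriorDerivative {K : Type*} [TopologicalSpace K] [ChartedSpace E7 K]
    [IsManifold (𝓡 7) (⊤ : ℕ∞) K]
    (η : ∀ x : K, T x →L[ℝ] ℝ) (ω : ∀ x : K, T x →L[ℝ] T x →L[ℝ] ℝ) : Prop :=
  ∀ (x : K) (X Y : ∀ y : K, T y), DiffFieldAt X x → DiffFieldAt Y x →
    ω x (X x) (Y x) = dirDeriv X (fun y ↦ η y (Y y)) x - dirDeriv Y (fun y ↦ η y (X y)) x
      - η x (bracket X Y x)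

/-- The differential form `Ω` is smooth: it is smooth on smooth vector fields. -/
def IsSmoothForm {K : Type*} [TopologicalSpace K] [ChartedSpace E7 K]
    [IsManifold (𝓡 7) (⊤ : ℕ∞) K] {n : ℕ}
    (Ω : ∀ x : K, T x [⋀^Fin n]→L[ℝ] ℂ) : Prop :=
  ∀ (x : K) (V : Fin n → ∀ y : K, T y), (∀ i, SmoothFieldAt (V i) x) →
    ContMDiffAt (𝓡 7) 𝓘(ℝ, ℂ) (⊤ : ℕ∞) (fun y ↦ Ω y (fun i ↦ V i y)) x

/-- `dΩ = 0`, where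
`dΩ(V₀, …, Vₙ₊₁) = ∑ᵢ (-1)ⁱ Vᵢ(Ω(…, V̂ᵢ, …)) + ∑_{i < j} (-1)^(i+j) Ω([Vᵢ, Vⱼ], …, V̂ᵢ, …, V̂ⱼ, …)`.
In the code the pair `i < j` is written as `(i.castSucc, j.succ)` with `i ≤ j`, whence the sign. -/
def IsClosedForm {K : Type*} [TopologicalSpace K] [ChartedSpace E7 K]
    [IsManifold (𝓡 7) (⊤ : ℕ∞) K] {n : ℕ}
    (Ω : ∀ x : K, T x [⋀^Fin (n + 1)]→L[ℝ] ℂ) : Prop :=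
  ∀ (x : K) (V : Fin (n + 2) → ∀ y : K, T y), (∀ i, DiffFieldAt (V i) x) →
    (∑ i : Fin (n + 2), (-1 : ℤ) ^ (i : ℕ) •
        dirDeriv (V i) (fun y ↦ Ω y (fun l ↦ V (i.succAbove l) y)) x)
      - ∑ i : Fin (n + 1), ∑ j ∈ Finset.Ici i, (-1 : ℤ) ^ ((i : ℕ) + (j : ℕ)) •
          Ω x (Matrix.vecCons (bracket (V i.castSucc) (V j.succ) x)
            (fun l : Fin n ↦ V (i.castSucc.succAbove (j.succAbove l)) x)) = 0

/-! ## Contact Calabi--Yau `7`-manifolds -/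

/-- A contact Calabi--Yau structure `(η, ξ, J, Ω)` on a `7`-manifold `K`, with `ω = dη`: a Sasakian
structure, whose transverse Kähler metric is `g_V = ω(·, J ·)`, together with a transverse
holomorphic volume form `Ω`, normalised by `ω³ / 3! = (Re Ω ∧ Im Ω) / 4`. -/
structure ContactCalabiYau (K : Type*) [TopologicalSpace K]
    [ChartedSpace E7 K] [IsManifold (𝓡 7) (⊤ : ℕ∞) K] where
  /-- The contact form (connection `1`-form of the circle fibration). -/
  η : ∀ x : K, T x →L[ℝ] ℝ
  /-- The Reeb vector field. -/
  ξ : ∀ x : K, T x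
  /-- The transverse complex structure, extended by `J ξ = 0`. -/
  J : ∀ x : K, T x →L[ℝ] T x
  /-- The transverse Kähler form `ω = dη`. -/
  ω : ∀ x : K, T x →L[ℝ] T x →L[ℝ] ℝ
  /-- The transverse holomorphic volume form. -/
  Ω : ∀ x : K, T x [⋀^Fin 3]→L[ℝ] ℂ
  smooth_η : ContMDiff (𝓡 7) ((𝓡 7).prod 𝓘(ℝ, E7 →L[ℝ] ℝ)) (⊤ : ℕ∞)
    (fun x ↦ Bundle.TotalSpace.mk' (E7 →L[ℝ] ℝ) (E := fun y : K ↦ T y →L[ℝ] ℝ) x (η x))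
  smooth_ξ : ContMDiff (𝓡 7) ((𝓡 7).prod 𝓘(ℝ, E7)) (⊤ : ℕ∞)
    (fun x ↦ Bundle.TotalSpace.mk' E7 (E := fun y : K ↦ T y) x (ξ x))
  smooth_J : ContMDiff (𝓡 7) ((𝓡 7).prod 𝓘(ℝ, E7 →L[ℝ] E7)) (⊤ : ℕ∞)
    (fun x ↦ Bundle.TotalSpace.mk' (E7 →L[ℝ] E7) (E := fun y : K ↦ T y →L[ℝ] T y) x (J x))
  smooth_ω : ContMDiff (𝓡 7) ((𝓡 7).prod 𝓘(ℝ, E7 →L[ℝ] E7 →L[ℝ] ℝ)) (⊤ : ℕ∞)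
    (fun x ↦ Bundle.TotalSpace.mk' (E7 →L[ℝ] E7 →L[ℝ] ℝ)
      (E := fun y : K ↦ T y →L[ℝ] T y →L[ℝ] ℝ) x (ω x))
  smooth_Ω : IsSmoothForm Ω
  ω_self : ∀ (x : K) (X : T x), ω x X X = 0
  dη_eq : IsExteriorDerivative η ω
  η_ξ : ∀ x : K, η x (ξ x) = 1
  ω_ξ : ∀ (x : K) (X : T x), ω x (ξ x) X = 0
  J_ξ : ∀ x : K, J x (ξ x) = 0
  J_J : ∀ (x : K) (X : T x), J x (J x X) = -X + η x X • ξ x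
  ω_J_J : ∀ (x : K) (X Y : T x), ω x (J x X) (J x Y) = ω x X Y
  ω_J_pos : ∀ (x : K) (X : T x), η x X = 0 → X ≠ 0 → 0 < ω x X (J x X)
  /-- Normality: `N_J + dη ⊗ ξ = 0`, where `N_J` is the Nijenhuis tensor of `J`. -/
  normal : ∀ (x : K) (X Y : ∀ y : K, T y), DiffFieldAt X x → DiffFieldAt Y x →
    bracket (fun y ↦ J y (X y)) (fun y ↦ J y (Y y)) x + J x (J x (bracket X Y x))
      - J x (bracket (fun y ↦ J y (X y)) Y x) - J x (bracket X (fun y ↦ J y (Y y)) x)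
      + ω x (X x) (Y x) • ξ x = 0
  /-- `Ω` is horizontal. -/
  Ω_ξ : ∀ (x : K) (Y Z : T x), Ω x ![ξ x, Y, Z] = 0
  /-- `Ω` is of type `(3, 0)`. -/
  Ω_J : ∀ (x : K) (X Y Z : T x), Ω x ![J x X, Y, Z] = Complex.I * Ω x ![X, Y, Z]
  closed_Ω : IsClosedForm Ω
  /-- `ω³ / 3! = (Re Ω ∧ Im Ω) / 4`. -/
  volume_eq : ∀ (x : K) (v : Fin 6 → T x),
    wedge (p := 2 + 2) (q := 2) (wedge (p := 2) (q := 2) (fun u ↦ ω x (u 0) (u 1))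
      (fun u ↦ ω x (u 0) (u 1))) (fun u ↦ ω x (u 0) (u 1)) v / (Nat.factorial 3 : ℝ)
    = wedge (p := 3) (q := 3) (fun u ↦ (Ω x u).re) (fun u ↦ (Ω x u).im) v / 4

namespace ContactCalabiYau

variable {K : Type*} [TopologicalSpace K] [ChartedSpace E7 K] [IsManifold (𝓡 7) (⊤ : ℕ∞) K]

/-- The transverse metric `g_V = ω(·, J ·)`, pulled back to `K`. -/
def gV (S : ContactCalabiYau K) (x : K) : LinearMap.BilinForm ℝ (T x) :=
  LinearMap.mk₂ ℝ (fun X Y ↦ S.ω x X (S.J x Y)) (by simp) (by simp) (by simp) (by simp)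

/-- The metric `g_ε = ε² η ⊗ η + g_V` on `K`. -/
def metric (S : ContactCalabiYau K) (ε : ℝ) (x : K) : LinearMap.BilinForm ℝ (T x) :=
  LinearMap.mk₂ ℝ (fun X Y ↦ ε ^ 2 * (S.η x X * S.η x Y) + S.gV x X Y)
    (by intros; simp; ring) (by intros; simp; ring) (by intros; simp; ring) (by intros; simp; ring)

theorem gV_apply (S : ContactCalabiYau K) (x : K) (X Y : T x) :
    S.gV x X Y = S.ω x X (S.J x Y) := rfl

theorem metric_apply (S : ContactCalabiYau K) (ε : ℝ) (x : K) (X Y : T x) :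
    S.metric ε x X Y = ε ^ 2 * (S.η x X * S.η x Y) + S.gV x X Y := rfl

theorem ω_swap (S : ContactCalabiYau K) (x : K) (X Y : T x) : S.ω x X Y = -S.ω x Y X := by
  have h := S.ω_self x (X + Y)
  simp only [map_add, add_apply, S.ω_self] at h
  linarith

theorem ω_ξ' (S : ContactCalabiYau K) (x : K) (X : T x) : S.ω x X (S.ξ x) = 0 := by
  rw [S.ω_swap, S.ω_ξ, neg_zero]

theorem gV_symm (S : ContactCalabiYau K) (x : K) (X Y : T x) : S.gV x X Y = S.gV x Y X := by
  rw [gV_apply, gV_apply, ← S.ω_J_J x X, S.J_J, map_add, map_neg, map_smul, S.ω_ξ',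
    S.ω_swap x Y]
  simp

theorem gV_ξ (S : ContactCalabiYau K) (x : K) (X : T x) : S.gV x X (S.ξ x) = 0 := by
  rw [gV_apply, S.J_ξ, map_zero]

theorem metric_pos (S : ContactCalabiYau K) {ε : ℝ} (hε : 0 < ε) (x : K) (X : T x) (hX : X ≠ 0) :
    0 < S.metric ε x X X := by
  have hg : S.gV x X X
      = S.gV x (X - S.η x X • S.ξ x) (X - S.η x X • S.ξ x) := by
    simp only [map_sub, map_smul, LinearMap.sub_apply, LinearMap.smul_apply, S.gV_ξ,
      S.gV_symm x (S.ξ x)]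
    simp
  by_cases h : X - S.η x X • S.ξ x = 0
  · have hη : S.η x X ≠ 0 := by
      intro h0
      rw [h0, zero_smul, sub_zero] at h
      exact hX h
    rw [metric_apply, hg, h]
    simp only [map_zero, add_zero]
    have := mul_self_pos.mpr hη
    positivity
  · have h1 : 0 < S.gV x (X - S.η x X • S.ξ x) (X - S.η x X • S.ξ x) :=
      S.ω_J_pos x _ (by simp [S.η_ξ]) h
    rw [metric_apply, hg]
    have := mul_self_nonneg (S.η x X)
    positivity

theorem metric_nondegenerate (S : ContactCalabiYau K) {ε : ℝ} (hε : 0 < ε) (x : K) :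
    (S.metric ε x).Nondegenerate := by
  constructor
  · intro X h
    by_contra hX
    exact (S.metric_pos hε x X hX).ne' (h X)
  · intro X h
    by_contra hX
    exact (S.metric_pos hε x X hX).ne' (h X)

/-- Raising an index with `g_ε`: the vector `v` with `g_ε(v, ·) = l`. -/
def sharp (S : ContactCalabiYau K) {ε : ℝ} (hε : 0 < ε) (x : K) :
    Module.Dual ℝ (T x) →ₗ[ℝ] T x :=
  ((S.metric ε x).toDual (S.metric_nondegenerate hε x)).symm.toLinearMap

theorem metric_sharp (S : ContactCalabiYau K) {ε : ℝ} (hε : 0 < ε) (x : K)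
    (l : Module.Dual ℝ (T x)) (Z : T x) : S.metric ε x (S.sharp hε x l) Z = l Z :=
  LinearMap.BilinForm.apply_toDual_symm_apply l Z

/-! ### The pulled-back Levi-Civita connection `A` of `g_V` -/

/-- The horizontal part of a vector field. -/
def hor (S : ContactCalabiYau K) (Z : ∀ y : K, T y) : ∀ y : K, T y :=
  fun y ↦ Z y - S.η y (Z y) • S.ξ y

/-- The right-hand side of the Koszul formula for `g_V`:
`X g(Y,Z) + Y g(X,Z) - Z g(X,Y) + g([X,Y],Z) - g([X,Z],Y) - g([Y,Z],X)`. -/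
def koszul (S : ContactCalabiYau K) (X Y Z : ∀ y : K, T y) (x : K) : ℝ :=
  dirDeriv X (fun y ↦ S.gV y (Y y) (Z y)) x + dirDeriv Y (fun y ↦ S.gV y (X y) (Z y)) x
    - dirDeriv Z (fun y ↦ S.gV y (X y) (Y y)) x
    + S.gV x (bracket X Y x) (Z x) - S.gV x (bracket X Z x) (Y x) - S.gV x (bracket Y Z x) (X x)

/-- `A_X Y` paired with `Z`, in the metric `η ⊗ η + g_V`: the vertical part of `A_X Y` is
`X(η(Y)) ξ`, and its horizontal part is given by the Koszul formula of `g_V`. -/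
def pairA (S : ContactCalabiYau K) (Y X Z : ∀ y : K, T y) (x : K) : ℝ :=
  dirDeriv X (fun y ↦ S.η y (Y y)) x * S.η x (Z x) + (1 / 2) * S.koszul X Y (S.hor Z) x

variable {S : ContactCalabiYau K} {x : K} {X X' Y Y' Z Z' : ∀ y : K, T y} {f g : K → ℝ}

theorem dirDeriv_add (hf : MDifferentiableAt (𝓡 7) 𝓘(ℝ, ℝ) f x)
    (hg : MDifferentiableAt (𝓡 7) 𝓘(ℝ, ℝ) g x) :
    dirDeriv X (fun y ↦ f y + g y) x = dirDeriv X f x + dirDeriv X g x := by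
  have := mvfderiv_add hf hg
  unfold dirDeriv
  rw [show (fun y ↦ f y + g y) = f + g from rfl, this]
  rfl

theorem dirDeriv_mul (hf : MDifferentiableAt (𝓡 7) 𝓘(ℝ, ℝ) f x)
    (hg : MDifferentiableAt (𝓡 7) 𝓘(ℝ, ℝ) g x) :
    dirDeriv X (fun y ↦ f y * g y) x = f x * dirDeriv X g x + dirDeriv X f x * g x := by
  have := mvfderiv_mul hf hg
  unfold dirDeriv
  rw [show (fun y ↦ f y * g y) = f * g from rfl, this]
  simp [mul_comm]

theorem diff_η (hY : DiffFieldAt Y x) :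
    MDifferentiableAt (𝓡 7) 𝓘(ℝ, ℝ) (fun y ↦ S.η y (Y y)) x := by
  have := MDifferentiableAt.clm_bundle_apply (E₂ := Bundle.Trivial K ℝ)
    ((S.smooth_η x).mdifferentiableAt (by simp)) hY
  rw [mdifferentiableAt_totalSpace] at this
  exact this.2

theorem diff_J (hY : DiffFieldAt Y x) : DiffFieldAt (fun y ↦ S.J y (Y y)) x :=
  ((S.smooth_J x).mdifferentiableAt (by simp)).clm_bundle_apply hY

theorem diff_gV (hX : DiffFieldAt X x) (hY : DiffFieldAt Y x) :
    MDifferentiableAt (𝓡 7) 𝓘(ℝ, ℝ) (fun y ↦ S.gV y (X y) (Y y)) x := by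
  have := MDifferentiableAt.clm_bundle_apply₂ (E₃ := Bundle.Trivial K ℝ)
    ((S.smooth_ω x).mdifferentiableAt (by simp)) hX (diff_J (S := S) hY)
  rw [mdifferentiableAt_totalSpace] at this
  exact this.2

theorem diff_ξ (S : ContactCalabiYau K) (x : K) : DiffFieldAt S.ξ x :=
  (S.smooth_ξ x).mdifferentiableAt (by simp)

theorem diff_hor (hZ : DiffFieldAt Z x) : DiffFieldAt (S.hor Z) x :=
  mdifferentiableAt_sub_section hZ ((diff_η (S := S) hZ).smul_section (S.diff_ξ x))

theorem dirDeriv_field_smul (h : K → ℝ) :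
    dirDeriv (f • X) h x = f x * dirDeriv X h x := by
  simp [dirDeriv]

theorem dirDeriv_field_add (h : K → ℝ) :
    dirDeriv (X + X') h x = dirDeriv X h x + dirDeriv X' h x := by
  simp [dirDeriv]

theorem bracket_smul_left (hf : MDifferentiableAt (𝓡 7) 𝓘(ℝ, ℝ) f x) (hX : DiffFieldAt X x) :
    bracket (f • X) Y x = -(dirDeriv Y f x • X x) + f x • bracket X Y x := by
  have := VectorField.mlieBracket_smul_left (W := Y) hf hX
  simpa [dirDeriv] using this

theorem bracket_smul_right (hf : MDifferentiableAt (𝓡 7) 𝓘(ℝ, ℝ) f x) (hY : DiffFieldAt Y x) :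
    bracket X (f • Y) x = dirDeriv X f x • Y x + f x • bracket X Y x :=
  VectorField.mlieBracket_smul_right (V := X) hf hY

theorem bracket_add_left (hX : DiffFieldAt X x) (hX' : DiffFieldAt X' x) :
    bracket (X + X') Y x = bracket X Y x + bracket X' Y x :=
  VectorField.mlieBracket_add_left hX hX'

theorem bracket_add_right (hY : DiffFieldAt Y x) (hY' : DiffFieldAt Y' x) :
    bracket X (Y + Y') x = bracket X Y x + bracket X Y' x :=
  VectorField.mlieBracket_add_right hY hY'

theorem hor_smul : S.hor (f • Z) = f • S.hor Z := by
  funext y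
  simp [hor, smul_sub, smul_smul]

theorem hor_add : S.hor (Z + Z') = S.hor Z + S.hor Z' := by
  funext y
  simp only [hor, Pi.add_apply, map_add, add_smul]
  abel

theorem koszul_smul_left (hf : MDifferentiableAt (𝓡 7) 𝓘(ℝ, ℝ) f x) (hX : DiffFieldAt X x)
    (hY : DiffFieldAt Y x) (hZ : DiffFieldAt Z x) :
    S.koszul (f • X) Y Z x = f x * S.koszul X Y Z x := by
  simp only [koszul, dirDeriv_field_smul, bracket_smul_left hf hX, Pi.smul_apply', map_smul,
    LinearMap.smul_apply, smul_eq_mul, map_add, map_neg, LinearMap.add_apply, LinearMap.neg_apply,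
    dirDeriv_mul hf (diff_gV (S := S) hX hZ), dirDeriv_mul hf (diff_gV (S := S) hX hY)]
  ring

theorem koszul_add_left (hX : DiffFieldAt X x) (hX' : DiffFieldAt X' x)
    (hY : DiffFieldAt Y x) (hZ : DiffFieldAt Z x) :
    S.koszul (X + X') Y Z x = S.koszul X Y Z x + S.koszul X' Y Z x := by
  simp only [koszul, dirDeriv_field_add, bracket_add_left hX hX', Pi.add_apply, map_add,
    LinearMap.add_apply, dirDeriv_add (diff_gV (S := S) hX hZ) (diff_gV (S := S) hX' hZ),
    dirDeriv_add (diff_gV (S := S) hX hY) (diff_gV (S := S) hX' hY)]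
  ring

theorem koszul_smul_right (hf : MDifferentiableAt (𝓡 7) 𝓘(ℝ, ℝ) f x) (hX : DiffFieldAt X x)
    (hY : DiffFieldAt Y x) (hZ : DiffFieldAt Z x) :
    S.koszul X Y (f • Z) x = f x * S.koszul X Y Z x := by
  simp only [koszul, dirDeriv_field_smul, bracket_smul_right hf hZ, Pi.smul_apply', map_smul,
    LinearMap.smul_apply, smul_eq_mul, map_add, LinearMap.add_apply,
    dirDeriv_mul hf (diff_gV (S := S) hX hZ), dirDeriv_mul hf (diff_gV (S := S) hY hZ),
    S.gV_symm x (Z x)]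
  ring

theorem koszul_add_right (hX : DiffFieldAt X x) (hY : DiffFieldAt Y x) (hZ : DiffFieldAt Z x)
    (hZ' : DiffFieldAt Z' x) :
    S.koszul X Y (Z + Z') x = S.koszul X Y Z x + S.koszul X Y Z' x := by
  simp only [koszul, dirDeriv_field_add, bracket_add_right hZ hZ', Pi.add_apply, map_add,
    LinearMap.add_apply, dirDeriv_add (diff_gV (S := S) hX hZ) (diff_gV (S := S) hX hZ'),
    dirDeriv_add (diff_gV (S := S) hY hZ) (diff_gV (S := S) hY hZ')]
  ring

theorem koszul_smul_middle (hf : MDifferentiableAt (𝓡 7) 𝓘(ℝ, ℝ) f x) (hX : DiffFieldAt X x)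
    (hY : DiffFieldAt Y x) (hZ : DiffFieldAt Z x) :
    S.koszul X (f • Y) Z x
      = f x * S.koszul X Y Z x + 2 * (dirDeriv X f x * S.gV x (Y x) (Z x)) := by
  simp only [koszul, dirDeriv_field_smul, bracket_smul_right hf hY, bracket_smul_left hf hY,
    Pi.smul_apply', map_smul, LinearMap.smul_apply, smul_eq_mul, map_add, map_neg,
    LinearMap.add_apply, LinearMap.neg_apply, dirDeriv_mul hf (diff_gV (S := S) hY hZ),
    dirDeriv_mul hf (diff_gV (S := S) hX hY), S.gV_symm x (Y x) (X x)]
  ring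

theorem koszul_add_middle (hX : DiffFieldAt X x) (hY : DiffFieldAt Y x) (hY' : DiffFieldAt Y' x)
    (hZ : DiffFieldAt Z x) :
    S.koszul X (Y + Y') Z x = S.koszul X Y Z x + S.koszul X Y' Z x := by
  simp only [koszul, dirDeriv_field_add, bracket_add_right hY hY', bracket_add_left hY hY',
    Pi.add_apply, map_add, LinearMap.add_apply,
    dirDeriv_add (diff_gV (S := S) hY hZ) (diff_gV (S := S) hY' hZ),
    dirDeriv_add (diff_gV (S := S) hX hY) (diff_gV (S := S) hX hY')]
  ring

theorem tensorial_pairA_left (hY : DiffFieldAt Y x) (hZ : DiffFieldAt Z x) :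
    TensorialAt (𝓡 7) E7 (fun X : ∀ y : K, TangentSpace (𝓡 7) y ↦ S.pairA Y X Z x) x where
  smul hf hX := by
    simp only [pairA, dirDeriv_field_smul, koszul_smul_left hf hX hY (diff_hor hZ), smul_eq_mul]
    ring
  add hX hX' := by
    simp only [pairA, dirDeriv_field_add, koszul_add_left hX hX' hY (diff_hor hZ)]
    ring

theorem tensorial_pairA_right (hY : DiffFieldAt Y x) (hX : DiffFieldAt X x) :
    TensorialAt (𝓡 7) E7 (fun Z : ∀ y : K, TangentSpace (𝓡 7) y ↦ S.pairA Y X Z x) x where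
  smul hf hZ := by
    simp only [pairA, hor_smul, koszul_smul_right hf hX hY (diff_hor hZ), Pi.smul_apply',
      map_smul, smul_eq_mul]
    ring
  add hZ hZ' := by
    simp only [pairA, hor_add, koszul_add_right hX hY (diff_hor hZ) (diff_hor hZ'), Pi.add_apply,
      map_add]
    ring

open Classical in
/-- The connection `A` on `TK = ℝ ξ ⊕ π^* TV` given by the pull-back of the Levi-Civita connection
of `g_V` on `π^* TV = ker η` and the trivial connection on `ℝ ξ`, as an operator
`Y ↦ (X ↦ A_X Y)` (with the value `0` at points where `Y` is not differentiable). -/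
def covA (S : ContactCalabiYau K) (Y : ∀ y : K, TangentSpace (𝓡 7) y) (x : K) :
    TangentSpace (𝓡 7) x →L[ℝ] TangentSpace (𝓡 7) x :=
  if hY : DiffFieldAt Y x then
    letI Ψ : T x →L[ℝ] T x →L[ℝ] ℝ := TensorialAt.mkHom₂ (fun X Z ↦ S.pairA Y X Z x) x
      (fun _ hZ ↦ tensorial_pairA_left hY hZ) (fun _ hX ↦ tensorial_pairA_right hY hX)
    LinearMap.toContinuousLinearMap
      { toFun X := S.sharp one_pos x (Ψ X).toLinearMap
        map_add' X X' :=
          (congrArg (fun l : T x →L[ℝ] ℝ ↦ S.sharp one_pos x l.toLinearMap) (map_add Ψ X X')).trans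
            (map_add (S.sharp one_pos x) (Ψ X).toLinearMap (Ψ X').toLinearMap)
        map_smul' c X :=
          (congrArg (fun l : T x →L[ℝ] ℝ ↦ S.sharp one_pos x l.toLinearMap) (map_smul Ψ c X)).trans
            (map_smul (S.sharp one_pos x) c (Ψ X).toLinearMap) }
  else 0

/-- The defining property of `A`: `g_1(A_X Y, Z)` is `pairA`. -/
theorem metric_covA (hX : DiffFieldAt X x) (hY : DiffFieldAt Y x) (hZ : DiffFieldAt Z x) :
    S.metric 1 x (S.covA Y x (X x)) (Z x) = S.pairA Y X Z x := by
  rw [covA, dif_pos hY]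
  simp only [LinearMap.coe_toContinuousLinearMap', LinearMap.coe_mk, AddHom.coe_mk, metric_sharp]
  exact TensorialAt.mkHom₂_apply _ _ hX hZ

theorem eq_of_metric {u v : T x} (h : ∀ w : T x, S.metric 1 x u w = S.metric 1 x v w) : u = v := by
  have := (S.metric_nondegenerate one_pos x).1 (u - v) fun w ↦ by
    rw [map_sub, LinearMap.sub_apply, h, sub_self]
  exact sub_eq_zero.mp this

theorem isCovariantDerivativeOn_covA (S : ContactCalabiYau K) :
    IsCovariantDerivativeOn E7 (I := 𝓡 7) (M := K) S.covA Set.univ where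
  add {Y Y' x} hY hY' _ := by
    ext1 X₀
    refine eq_of_metric (S := S) fun Z₀ ↦ ?_
    obtain ⟨X, hX, rfl⟩ : ∃ X : ∀ y : K, T y, DiffFieldAt X x ∧ X x = X₀ :=
      ⟨FiberBundle.extend E7 X₀, FiberBundle.mdifferentiableAt_extend .., by simp⟩
    obtain ⟨Z, hZ, rfl⟩ : ∃ Z : ∀ y : K, T y, DiffFieldAt Z x ∧ Z x = Z₀ :=
      ⟨FiberBundle.extend E7 Z₀, FiberBundle.mdifferentiableAt_extend .., by simp⟩
    rw [metric_covA hX (mdifferentiableAt_add_section hY hY') hZ, add_apply, map_add,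
      LinearMap.add_apply, metric_covA hX hY hZ, metric_covA hX hY' hZ]
    simp only [pairA, koszul_add_middle hX hY hY' (diff_hor hZ), Pi.add_apply, map_add,
      dirDeriv_add (diff_η (S := S) hY) (diff_η (S := S) hY')]
    ring
  leibniz {Y f x} hY hf _ := by
    ext1 X₀
    refine eq_of_metric (S := S) fun Z₀ ↦ ?_
    obtain ⟨X, hX, rfl⟩ : ∃ X : ∀ y : K, T y, DiffFieldAt X x ∧ X x = X₀ :=
      ⟨FiberBundle.extend E7 X₀, FiberBundle.mdifferentiableAt_extend .., by simp⟩
    obtain ⟨Z, hZ, rfl⟩ : ∃ Z : ∀ y : K, T y, DiffFieldAt Z x ∧ Z x = Z₀ :=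
      ⟨FiberBundle.extend E7 Z₀, FiberBundle.mdifferentiableAt_extend .., by simp⟩
    rw [metric_covA hX (hf.smul_section hY) hZ]
    have h1 : (f x • S.covA Y x + (mvfderiv (𝓡 7) f x).smulRight (Y x)) (X x)
        = f x • S.covA Y x (X x) + dirDeriv X f x • Y x := rfl
    have h2 : S.gV x (Y x) (S.hor Z x) = S.gV x (Y x) (Z x) := by
      simp [hor, S.gV_ξ]
    rw [h1, map_add, map_smul, map_smul, LinearMap.add_apply, LinearMap.smul_apply,
      LinearMap.smul_apply, metric_covA hX hY hZ]
    simp only [pairA, koszul_smul_middle hf hX hY (diff_hor hZ), Pi.smul_apply', map_smul,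
      smul_eq_mul, dirDeriv_mul hf (diff_η (S := S) hY), h2, metric_apply]
    ring

/-- The connection `A` on `TK`. -/
def connA (S : ContactCalabiYau K) :
    CovariantDerivative (𝓡 7) E7 (TangentSpace (𝓡 7) : K → Type _) where
  toFun := S.covA
  isCovariantDerivativeOnUniv := S.isCovariantDerivativeOn_covA

/-! ### The tensors `B`, `C`, `e₀ 𝓘` and the connections `θ` -/

/-- The flux `H_ε = -ε² η ∧ ω + ε Re Ω`. -/
def flux (S : ContactCalabiYau K) (ε : ℝ) (x : K) (X Y Z : T x) : ℝ :=
  -ε ^ 2 * (S.η x X * S.ω x Y Z + S.η x Y * S.ω x Z X + S.η x Z * S.ω x X Y)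
    + ε * (S.Ω x ![X, Y, Z]).re

theorem flux_add_left (S : ContactCalabiYau K) (ε : ℝ) (x : K) (X X' Y Z : T x) :
    S.flux ε x (X + X') Y Z = S.flux ε x X Y Z + S.flux ε x X' Y Z := by
  have h : S.Ω x ![X + X', Y, Z] = S.Ω x ![X, Y, Z] + S.Ω x ![X', Y, Z] :=
    (S.Ω x).toMultilinearMap.cons_add ![Y, Z] X X'
  simp only [flux, h, map_add, add_apply, Complex.add_re]
  ring

theorem flux_smul_left (S : ContactCalabiYau K) (ε : ℝ) (x : K) (c : ℝ) (X Y Z : T x) :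
    S.flux ε x (c • X) Y Z = c * S.flux ε x X Y Z := by
  have h : S.Ω x ![c • X, Y, Z] = c • S.Ω x ![X, Y, Z] :=
    (S.Ω x).toMultilinearMap.cons_smul ![Y, Z] c X
  simp only [flux, h, map_smul, smul_apply, Complex.smul_re, smul_eq_mul]
  ring

theorem Ω_swap (S : ContactCalabiYau K) (x : K) (X Y Z : T x) :
    S.Ω x ![Y, X, Z] = -S.Ω x ![X, Y, Z] := by
  refine Eq.trans (congrArg (S.Ω x) ?_)
    ((S.Ω x).map_swap ![X, Y, Z] (show (0 : Fin 3) ≠ 1 by decide))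
  funext i
  fin_cases i <;> rfl

theorem Ω_swap' (S : ContactCalabiYau K) (x : K) (X Y Z : T x) :
    S.Ω x ![X, Z, Y] = -S.Ω x ![X, Y, Z] := by
  refine Eq.trans (congrArg (S.Ω x) ?_)
    ((S.Ω x).map_swap ![X, Y, Z] (show (1 : Fin 3) ≠ 2 by decide))
  funext i
  fin_cases i <;> rfl

theorem flux_cyclic (S : ContactCalabiYau K) (ε : ℝ) (x : K) (X Y Z : T x) :
    S.flux ε x X Y Z = S.flux ε x Y Z X := by
  simp only [flux, S.Ω_swap' x Y X Z, S.Ω_swap x X Y Z, neg_neg]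
  ring

/-- `H_ε(X, Y, ·)`. -/
def fluxDual (S : ContactCalabiYau K) (ε : ℝ) (x : K) (X Y : T x) : Module.Dual ℝ (T x) where
  toFun Z := S.flux ε x X Y Z
  map_add' Z Z' := by
    rw [S.flux_cyclic, S.flux_cyclic, flux_add_left, ← S.flux_cyclic ε x Y, ← S.flux_cyclic ε x X,
      ← S.flux_cyclic ε x Y, ← S.flux_cyclic ε x X]
  map_smul' c Z := by
    rw [S.flux_cyclic, S.flux_cyclic, flux_smul_left, ← S.flux_cyclic ε x Y, ← S.flux_cyclic ε x X]
    rfl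

/-- `C(X) Y`: the tensor `ε⁻¹ H_ε` with an index raised, `g_ε(C(X) Y, Z) = ε⁻¹ H_ε(X, Y, Z)`. -/
def tensorC (S : ContactCalabiYau K) {ε : ℝ} (hε : 0 < ε) (x : K) (X Y : T x) : T x :=
  ε⁻¹ • S.sharp hε x (S.fluxDual ε x X Y)

/-- `B(X) Y`. -/
def tensorB (S : ContactCalabiYau K) (ε : ℝ) (x : K) (X Y : T x) : T x :=
  -(ε⁻¹ * S.ω x X Y) • S.ξ x + (ε * S.η x Y) • S.J x X + (ε * S.η x X) • S.J x Y

/-- `(e₀ 𝓘)(X) Y`, where `e₀ = ε η` and `𝓘 = J`. -/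
def tensorI (S : ContactCalabiYau K) (ε : ℝ) (x : K) (X Y : T x) : T x :=
  (ε * S.η x X) • S.J x Y

theorem fluxDual_add_left (S : ContactCalabiYau K) (ε : ℝ) (x : K) (X X' Y : T x) :
    S.fluxDual ε x (X + X') Y = S.fluxDual ε x X Y + S.fluxDual ε x X' Y :=
  LinearMap.ext fun Z ↦ S.flux_add_left ε x X X' Y Z

theorem fluxDual_smul_left (S : ContactCalabiYau K) (ε : ℝ) (x : K) (c : ℝ) (X Y : T x) :
    S.fluxDual ε x (c • X) Y = c • S.fluxDual ε x X Y :=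
  LinearMap.ext fun Z ↦ S.flux_smul_left ε x c X Y Z

theorem fluxDual_add_right (S : ContactCalabiYau K) (ε : ℝ) (x : K) (X Y Y' : T x) :
    S.fluxDual ε x X (Y + Y') = S.fluxDual ε x X Y + S.fluxDual ε x X Y' :=
  LinearMap.ext fun Z ↦ by
    change S.flux ε x X (Y + Y') Z = S.flux ε x X Y Z + S.flux ε x X Y' Z
    rw [S.flux_cyclic, flux_add_left, ← S.flux_cyclic ε x X, ← S.flux_cyclic ε x X]

theorem fluxDual_smul_right (S : ContactCalabiYau K) (ε : ℝ) (x : K) (c : ℝ) (X Y : T x) :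
    S.fluxDual ε x X (c • Y) = c • S.fluxDual ε x X Y :=
  LinearMap.ext fun Z ↦ by
    change S.flux ε x X (c • Y) Z = c * S.flux ε x X Y Z
    rw [S.flux_cyclic, flux_smul_left, ← S.flux_cyclic ε x X]

/-- The endomorphism-valued `1`-form `(kε/2) B + (kεδ/2) C + (kmε/2) e₀ 𝓘`, as `Y ↦ (X ↦ ·)`. -/
def twistForm (S : ContactCalabiYau K) {ε : ℝ} (hε : 0 < ε) (δ k m : ℝ) (x : K) :
    TangentSpace (𝓡 7) x →L[ℝ] TangentSpace (𝓡 7) x →L[ℝ] TangentSpace (𝓡 7) x :=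
  LinearMap.toContinuousBilinearMap (LinearMap.mk₂ ℝ
    (fun Y X : T x ↦ (k * ε / 2) • S.tensorB ε x X Y + (k * ε * δ / 2) • S.tensorC hε x X Y
      + (k * m * ε / 2) • S.tensorI ε x X Y)
    (by
      intro Y Y' X
      simp only [tensorB, tensorC, tensorI, fluxDual_add_right, map_add]
      module)
    (by
      intro c Y X
      simp only [tensorB, tensorC, tensorI, fluxDual_smul_right, map_smul, smul_eq_mul]
      module)
    (by
      intro Y X X'
      simp only [tensorB, tensorC, tensorI, fluxDual_add_left, map_add, add_apply]
      module)
    (by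
      intro c Y X
      simp only [tensorB, tensorC, tensorI, fluxDual_smul_left, map_smul, smul_apply, smul_eq_mul]
      module))

/-- The connection `θ^{δ,k}_{ε,m} = A + (kε/2) B + (kεδ/2) C + (kmε/2) e₀ 𝓘` on `TK`. -/
def twistedConnection (S : ContactCalabiYau K) {ε : ℝ} (hε : 0 < ε) (δ k m : ℝ) :
    CovariantDerivative (𝓡 7) E7 (TangentSpace (𝓡 7) : K → Type _) :=
  S.connA.addOneForm (S.twistForm hε δ k m)

/-! ### Matrices in adapted frames -/

/-- A frame of `T_x K` dual to an adapted coframe `e₀ = ε η, e₁, e₂, e₃, J e₁, J e₂, J e₃`, given by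
its horizontal vectors `f₁, f₂, f₃`: then `ω = ∑ eᵢ ∧ J eᵢ` and
`Ω = (e₁ + i J e₁) ∧ (e₂ + i J e₂) ∧ (e₃ + i J e₃)`. -/
structure AdaptedFrame (S : ContactCalabiYau K) (x : K) where
  /-- The horizontal vectors `f₁, f₂, f₃`. -/
  f : Fin 3 → T x
  η_f : ∀ i, S.η x (f i) = 0
  ω_f : ∀ i j, S.ω x (f i) (f j) = 0
  ω_f_J : ∀ i j, S.ω x (f i) (S.J x (f j)) = if i = j then 1 else 0
  Ω_f : S.Ω x ![f 0, f 1, f 2] = 1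

/-- Index set of the frame. -/
abbrev Idx : Type := Unit ⊕ Fin 3 ⊕ Fin 3

namespace AdaptedFrame

/-- The frame `ε⁻¹ ξ, f₁, f₂, f₃, J f₁, J f₂, J f₃`. -/
def vec (F : AdaptedFrame S x) (ε : ℝ) : Idx → T x :=
  Sum.elim (fun _ ↦ ε⁻¹ • S.ξ x) (Sum.elim F.f (fun i ↦ S.J x (F.f i)))

/-- The values `eᵢ(X)` of the coframe. -/
def e (F : AdaptedFrame S x) (X : T x) (i : Fin 3) : ℝ := S.gV x X (F.f i)

/-- The values `(J eᵢ)(X) = -eᵢ(J X)` of the coframe. -/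
def Je (F : AdaptedFrame S x) (X : T x) (i : Fin 3) : ℝ := -F.e (S.J x X) i

end AdaptedFrame

/-- The matrix `[a]`. -/
def box (a : Fin 3 → ℝ) : Matrix (Fin 3) (Fin 3) ℝ :=
  !![0, a 2, -a 1; -a 2, 0, a 0; a 1, -a 0, 0]

/-- The matrix `B`. -/
def matB (e₀ : ℝ) (e Je : Fin 3 → ℝ) : Matrix Idx Idx ℝ :=
  Matrix.fromBlocks 0 (Matrix.of fun _ ↦ Sum.elim Je (-e)) (Matrix.of fun i _ ↦ Sum.elim (-Je) e i)
    (Matrix.fromBlocks 0 (-e₀ • 1) (e₀ • 1) 0)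

/-- The matrix `C`. -/
def matC (e₀ : ℝ) (e Je : Fin 3 → ℝ) : Matrix Idx Idx ℝ :=
  Matrix.fromBlocks 0 (Matrix.of fun _ ↦ Sum.elim Je (-e)) (Matrix.of fun i _ ↦ Sum.elim (-Je) e i)
    (Matrix.fromBlocks (-box e) (e₀ • 1 + box Je) (-e₀ • 1 + box Je) (box e))

/-- The matrix `𝓘`. -/
def matI : Matrix Idx Idx ℝ :=
  Matrix.fromBlocks 0 0 0 (Matrix.fromBlocks 0 (-1) 1 0)

theorem η_J (S : ContactCalabiYau K) (x : K) (X : T x) : S.η x (S.J x X) = 0 := by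
  have h := congrArg (S.J x) (S.J_J x X)
  rw [S.J_J, map_add, map_neg, map_smul, S.J_ξ, smul_zero, add_zero, add_eq_left] at h
  have h' := congrArg (S.η x) h
  simpa [S.η_ξ] using h'

theorem gV_J (S : ContactCalabiYau K) (x : K) (X Y : T x) :
    S.gV x X (S.J x Y) = -S.ω x X Y := by
  rw [gV_apply, S.J_J, map_add, map_neg, map_smul, S.ω_ξ']
  simp

theorem AdaptedFrame.Je_eq (F : AdaptedFrame S x) (X : T x) (i : Fin 3) :
    F.Je X i = S.gV x X (S.J x (F.f i)) := by
  rw [Je, e, gV_J, gV_apply, S.ω_J_J]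

theorem gV_ξ_left (S : ContactCalabiYau K) (x : K) (X : T x) : S.gV x (S.ξ x) X = 0 := by
  rw [S.gV_symm, S.gV_ξ]

theorem AdaptedFrame.ω_J_f (F : AdaptedFrame S x) (i j : Fin 3) :
    S.ω x (S.J x (F.f i)) (F.f j) = -if i = j then 1 else 0 := by
  rw [S.ω_swap, F.ω_f_J]
  simp [eq_comm]

theorem AdaptedFrame.metric_vec (F : AdaptedFrame S x) {ε : ℝ} (hε : 0 < ε) (a b : Idx) :
    S.metric ε x (F.vec ε a) (F.vec ε b) = if a = b then 1 else 0 := by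
  have hε' := hε.ne'
  rcases a with _ | i | i <;> rcases b with _ | j | j <;>
    simp only [vec, metric_apply, Sum.elim_inl, Sum.elim_inr, gV_J, map_smul, LinearMap.smul_apply,
      smul_eq_mul, S.η_J, S.η_ξ, F.η_f, gV_ξ, gV_ξ_left, S.ω_ξ, F.ω_f, F.ω_J_f] <;>
    simp [gV_apply, F.ω_f_J, F.ω_f, S.ω_J_J]
  field_simp

theorem AdaptedFrame.expand (F : AdaptedFrame S x) {ε : ℝ} (hε : 0 < ε) (X : T x) :
    X = ∑ a, S.metric ε x X (F.vec ε a) • F.vec ε a := by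
  have key : ∀ (c : Idx → ℝ) (a : Idx),
      S.metric ε x (∑ b, c b • F.vec ε b) (F.vec ε a) = c a := fun c a ↦ by
    simp only [map_sum, LinearMap.sum_apply, map_smul, LinearMap.smul_apply, F.metric_vec hε,
      smul_eq_mul, mul_ite, mul_one, mul_zero, Finset.sum_ite_eq', Finset.mem_univ, if_true]
  have hli : LinearIndependent ℝ (F.vec ε) := by
    rw [Fintype.linearIndependent_iff]
    intro c hc a
    rw [← key c a, hc, map_zero, LinearMap.zero_apply]
  let b := basisOfLinearIndependentOfCardEqFinrank hli (by
    change _ = Module.finrank ℝ E7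
    simp)
  have hX := b.sum_repr X
  simp only [b, coe_basisOfLinearIndependentOfCardEqFinrank] at hX
  conv_lhs => rw [← hX]
  refine Finset.sum_congr rfl fun a _ ↦ ?_
  congr 1
  conv_rhs => rw [← hX]
  exact (key _ a).symm

theorem AdaptedFrame.metric_ext (F : AdaptedFrame S x) {ε : ℝ} (hε : 0 < ε) {u v : T x}
    (h : ∀ a, S.metric ε x u (F.vec ε a) = S.metric ε x v (F.vec ε a)) : u = v := by
  rw [F.expand hε u, F.expand hε v]
  simp only [h]

theorem AdaptedFrame.eq_sum (F : AdaptedFrame S x) {ε : ℝ} (hε : 0 < ε) {u : T x} (c : Idx → ℝ)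
    (h : ∀ a, S.metric ε x u (F.vec ε a) = c a) : u = ∑ a, c a • F.vec ε a := by
  rw [F.expand hε u]
  simp only [h]

theorem AdaptedFrame.ω_right (F : AdaptedFrame S x) (X : T x) (i : Fin 3) :
    S.ω x X (F.f i) = -F.Je X i := by
  rw [F.Je_eq, gV_J, neg_neg]

theorem AdaptedFrame.ω_J_right (F : AdaptedFrame S x) (X : T x) (i : Fin 3) :
    S.ω x X (S.J x (F.f i)) = F.e X i := rfl

theorem AdaptedFrame.e_add (F : AdaptedFrame S x) (X Y : T x) (i : Fin 3) :
    F.e (X + Y) i = F.e X i + F.e Y i := by simp [e]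

theorem AdaptedFrame.e_smul (F : AdaptedFrame S x) (c : ℝ) (X : T x) (i : Fin 3) :
    F.e (c • X) i = c * F.e X i := by simp [e]

theorem AdaptedFrame.Je_add (F : AdaptedFrame S x) (X Y : T x) (i : Fin 3) :
    F.Je (X + Y) i = F.Je X i + F.Je Y i := by simp [Je_eq]

theorem AdaptedFrame.Je_smul (F : AdaptedFrame S x) (c : ℝ) (X : T x) (i : Fin 3) :
    F.Je (c • X) i = c * F.Je X i := by simp [Je_eq]

theorem AdaptedFrame.e_zero (F : AdaptedFrame S x) (i : Fin 3) : F.e 0 i = 0 := by simp [e]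

theorem AdaptedFrame.Je_zero (F : AdaptedFrame S x) (i : Fin 3) : F.Je 0 i = 0 := by simp [Je_eq]

theorem AdaptedFrame.e_J (F : AdaptedFrame S x) (X : T x) (i : Fin 3) :
    F.e (S.J x X) i = -F.Je X i := by
  rw [Je, neg_neg]

theorem AdaptedFrame.Je_J (F : AdaptedFrame S x) (X : T x) (i : Fin 3) :
    F.Je (S.J x X) i = F.e X i := by
  rw [Je_eq, gV_apply, S.ω_J_J]
  rfl

theorem AdaptedFrame.e_ξ (F : AdaptedFrame S x) (i : Fin 3) : F.e (S.ξ x) i = 0 :=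
  S.gV_ξ_left x _

theorem AdaptedFrame.Je_ξ (F : AdaptedFrame S x) (i : Fin 3) : F.Je (S.ξ x) i = 0 := by
  rw [Je_eq, S.gV_ξ_left]

theorem AdaptedFrame.e_f (F : AdaptedFrame S x) (i j : Fin 3) :
    F.e (F.f i) j = if i = j then 1 else 0 := F.ω_f_J i j

theorem AdaptedFrame.Je_f (F : AdaptedFrame S x) (i j : Fin 3) : F.Je (F.f i) j = 0 := by
  rw [Je_eq, gV_J, F.ω_f, neg_zero]

theorem AdaptedFrame.metric_vec_right (F : AdaptedFrame S x) {ε : ℝ} (hε : 0 < ε) (X : T x)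
    (a : Idx) : S.metric ε x X (F.vec ε a)
      = Sum.elim (fun _ ↦ ε * S.η x X) (Sum.elim (F.e X) (F.Je X)) a := by
  rcases a with _ | i | i
  · simp only [vec, metric_apply, Sum.elim_inl, map_smul, smul_eq_mul, S.η_ξ, gV_ξ]
    field_simp
    ring
  · simp [vec, metric_apply, F.η_f, e]
  · simp [vec, metric_apply, S.η_J, F.Je_eq]

theorem tensorB_frame (F : AdaptedFrame S x) {ε : ℝ} (hε : 0 < ε) (X : T x) (b : Idx) :
    S.tensorB ε x X (F.vec ε b)
      = ∑ a, matB (ε * S.η x X) (F.e X) (F.Je X) a b • F.vec ε a := by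
  have hε' := hε.ne'
  refine F.eq_sum hε _ fun a ↦ ?_
  rw [F.metric_vec_right hε]
  rcases a with _ | i | i <;> rcases b with _ | j | j <;>
    simp [AdaptedFrame.vec, tensorB, matB, F.e_add, F.e_smul, F.Je_add, F.Je_smul, F.e_J, F.Je_J,
      F.e_ξ, F.Je_ξ, F.e_f, F.Je_f,
      F.ω_right, F.ω_J_right, S.η_J, S.η_ξ, F.η_f, S.ω_ξ', S.J_ξ, hε', Matrix.one_apply, eq_comm]
  all_goals first | (rw [← neg_smul, F.e_smul, F.e_ξ, mul_zero]) |
    (rw [← neg_smul, F.Je_smul, F.Je_ξ, mul_zero])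

theorem tensorI_frame (F : AdaptedFrame S x) {ε : ℝ} (hε : 0 < ε) (X : T x) (b : Idx) :
    S.tensorI ε x X (F.vec ε b)
      = ∑ a, ((ε * S.η x X) • matI) a b • F.vec ε a := by
  refine F.eq_sum hε _ fun a ↦ ?_
  rw [F.metric_vec_right hε]
  rcases a with _ | i | i <;> rcases b with _ | j | j <;>
    simp [AdaptedFrame.vec, tensorI, matI, F.e_smul, F.Je_smul, F.e_J,
      F.Je_J, F.e_f, F.Je_f, F.e_zero, F.Je_zero, S.η_J, S.J_ξ, Matrix.one_apply, eq_comm]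

theorem Ω_J' (S : ContactCalabiYau K) (x : K) (X Y Z : T x) :
    S.Ω x ![X, S.J x Y, Z] = Complex.I * S.Ω x ![X, Y, Z] := by
  rw [S.Ω_swap, S.Ω_J, S.Ω_swap x X Y]
  ring

theorem Ω_J'' (S : ContactCalabiYau K) (x : K) (X Y Z : T x) :
    S.Ω x ![X, Y, S.J x Z] = Complex.I * S.Ω x ![X, Y, Z] := by
  rw [S.Ω_swap', S.Ω_J', S.Ω_swap' x X Y Z]
  ring

theorem Ω_add (S : ContactCalabiYau K) (x : K) (X X' Y Z : T x) :
    S.Ω x ![X + X', Y, Z] = S.Ω x ![X, Y, Z] + S.Ω x ![X', Y, Z] :=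
  (S.Ω x).toMultilinearMap.cons_add ![Y, Z] X X'

theorem Ω_smul (S : ContactCalabiYau K) (x : K) (c : ℝ) (X Y Z : T x) :
    S.Ω x ![c • X, Y, Z] = c * S.Ω x ![X, Y, Z] :=
  (S.Ω x).toMultilinearMap.cons_smul ![Y, Z] c X

theorem AdaptedFrame.Ω_frame (F : AdaptedFrame S x) (X : T x) (i j : Fin 3) :
    S.Ω x ![X, F.f i, F.f j] = (box (F.e X) i j : ℂ) + Complex.I * (box (F.Je X) i j : ℂ) := by
  have hs : ∀ Y Z : T x, S.Ω x ![Y, Y, Z] = 0 := fun Y Z ↦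
    (S.Ω x).map_eq_zero_of_eq _ (i := 0) (j := 1) rfl (by decide)
  have hs' : ∀ Y Z : T x, S.Ω x ![Z, Y, Y] = 0 := fun Y Z ↦
    (S.Ω x).map_eq_zero_of_eq _ (i := 1) (j := 2) rfl (by decide)
  have hs'' : ∀ Y Z : T x, S.Ω x ![Y, Z, Y] = 0 := fun Y Z ↦
    (S.Ω x).map_eq_zero_of_eq _ (i := 0) (j := 2) rfl (by decide)
  have h0 := F.Ω_f
  have h1 : S.Ω x ![F.f 0, F.f 2, F.f 1] = -1 := by rw [S.Ω_swap', h0]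
  have h2 : S.Ω x ![F.f 1, F.f 0, F.f 2] = -1 := by rw [S.Ω_swap, h0]
  have h3 : S.Ω x ![F.f 1, F.f 2, F.f 0] = 1 := by rw [S.Ω_swap', h2, neg_neg]
  have h4 : S.Ω x ![F.f 2, F.f 0, F.f 1] = 1 := by rw [S.Ω_swap, h1, neg_neg]
  have h5 : S.Ω x ![F.f 2, F.f 1, F.f 0] = -1 := by rw [S.Ω_swap, h3]
  have hX := F.expand one_pos X
  conv_lhs => rw [hX]
  simp only [F.metric_vec_right one_pos]
  simp only [Fintype.sum_sum_type, Fin.sum_univ_three, Ω_add, Ω_smul,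
    AdaptedFrame.vec, Sum.elim_inl, Sum.elim_inr, Finset.univ_unique, Finset.sum_singleton, S.Ω_J,
    S.Ω_ξ]
  fin_cases i <;> fin_cases j <;> simp [hs, hs', hs'', h0, h1, h2, h3, h4, h5, box] <;> ring

theorem tensorC_frame (F : AdaptedFrame S x) {ε : ℝ} (hε : 0 < ε) (X : T x) (b : Idx) :
    S.tensorC hε x X (F.vec ε b)
      = ∑ a, matC (ε * S.η x X) (F.e X) (F.Je X) a b • F.vec ε a := by
  have hε' := hε.ne'
  have hbox : ∀ (a : Fin 3 → ℝ) (i j : Fin 3), box a i j = -box a j i := fun a i j ↦ by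
    fin_cases i <;> fin_cases j <;> simp [box]
  refine F.eq_sum hε _ fun a ↦ ?_
  rw [tensorC, map_smul, LinearMap.smul_apply, metric_sharp]
  change ε⁻¹ * S.flux ε x X _ _ = _
  have hξ' : ∀ Y Z : T x, S.Ω x ![Y, ε⁻¹ • S.ξ x, Z] = 0 := fun Y Z ↦ by
    rw [S.Ω_swap, S.Ω_smul, S.Ω_ξ, mul_zero, neg_zero]
  have hξ'' : ∀ Y Z : T x, S.Ω x ![Y, Z, ε⁻¹ • S.ξ x] = 0 := fun Y Z ↦ by
    rw [S.Ω_swap', hξ', neg_zero]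
  rcases a with _ | i | i <;> rcases b with _ | j | j <;>
    simp [AdaptedFrame.vec, flux, matC, hξ', hξ'', S.Ω_J', S.Ω_J'', F.Ω_frame, F.ω_f, F.ω_J_f,
      F.ω_f_J, S.ω_J_J, S.ω_ξ, S.ω_swap x _ X,
      F.ω_right, F.ω_J_right, S.η_J, S.η_ξ, F.η_f, S.ω_ξ', Matrix.one_apply]
  all_goals try rw [hbox _ j i]
  all_goals try simp only [eq_comm (a := j)]
  all_goals try split_ifs
  all_goals field_simp
  all_goals try ring

/-- In every adapted frame, `θ - A` has the matrix `(kε/2) B + (kεδ/2) C + (kmε/2) e₀ 𝓘`. -/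
theorem twistForm_frame (F : AdaptedFrame S x) {ε : ℝ} (hε : 0 < ε) (δ k m : ℝ) (X : T x)
    (b : Idx) :
    S.twistForm hε δ k m x (F.vec ε b) X
      = ∑ a, ((k * ε / 2) • matB (ε * S.η x X) (F.e X) (F.Je X)
          + (k * ε * δ / 2) • matC (ε * S.η x X) (F.e X) (F.Je X)
          + (k * m * ε / 2) • (ε * S.η x X) • matI) a b • F.vec ε a := by
  change (k * ε / 2) • S.tensorB ε x X (F.vec ε b)
    + (k * ε * δ / 2) • S.tensorC hε x X (F.vec ε b)
    + (k * m * ε / 2) • S.tensorI ε x X (F.vec ε b) = _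
  rw [tensorB_frame F hε, tensorC_frame F hε, tensorI_frame F hε, Finset.smul_sum, Finset.smul_sum,
    Finset.smul_sum, ← Finset.sum_add_distrib, ← Finset.sum_add_distrib]
  refine Finset.sum_congr rfl fun a _ ↦ ?_
  simp only [Matrix.add_apply, Matrix.smul_apply, smul_smul, add_smul, smul_eq_mul, mul_assoc]

/-- The torsion `T` of the connection `θ` is totally skew-symmetric with respect to `g_ε`:
`g_ε(T(X, Y), Z)` changes sign under transpositions of its arguments. -/
def HasTotallySkewTorsion (S : ContactCalabiYau K) (ε : ℝ)
    (θ : CovariantDerivative (𝓡 7) E7 (TangentSpace (𝓡 7) : K → Type _)) : Prop :=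
  ∀ (x : K) (X Y Z : T x),
    S.metric ε x (θ.torsion x X Y) Z = -S.metric ε x (θ.torsion x Y X) Z ∧
    S.metric ε x (θ.torsion x X Y) Z = -S.metric ε x (θ.torsion x X Z) Y ∧
    S.metric ε x (θ.torsion x X Y) Z = -S.metric ε x (θ.torsion x Z Y) X

end ContactCalabiYau
end ContactCY

end

/-!
The torsion of `θ` splits as the torsion of `A` plus the antisymmetrisation of the twisting
endomorphism-valued `1`-form.

* Antisymmetrising the Koszul formula leaves `g_V([X, Y], Z)`, so the horizontal part of the torsion
  of `A` vanishes, while its vertical part is `dη`: `T_A = ω ⊗ ξ` (`torsion_connA`).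
* In `B(X) Y - B(Y) X` the terms symmetric in `X, Y` drop out and `-2 ε⁻¹ ω(X, Y) ξ` remains; `C` is
  already totally skew and contributes a multiple of the flux `H_ε`; `e₀ 𝓘` contributes
  `η(X) ω(Y, Z) + η(Y) ω(Z, X)`.

Hence (`metric_torsion_twistedConnection`)
`g_ε(T(X, Y), Z) = ε² ((1 - k) ω(X, Y) η(Z) + (k m / 2) (η(X) ω(Y, Z) + η(Y) ω(Z, X))) + k δ H_ε`.
If `1 - k = k m / 2`, the term in parentheses is a multiple of `η ∧ ω`, so `T` is skew. Conversely,
evaluating the skew-symmetry on `(v, J v, ξ)` with `v ≠ 0` horizontal, where `ω(v, J v) > 0`, forces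
`1 - k = k m / 2`; such a `v` exists since `ker η` has dimension `6`.
-/

open scoped Manifold

noncomputable section

namespace ContactCY.ContactCalabiYau

variable {K : Type*} [TopologicalSpace K] [ChartedSpace E7 K] [IsManifold (𝓡 7) (⊤ : ℕ∞) K]

theorem gV_J_left (S : ContactCalabiYau K) (x : K) (X Y : T x) :
    S.gV x (S.J x X) Y = S.ω x X Y := by
  rw [gV_apply, S.ω_J_J]

/-- All the other terms of the Koszul formula are symmetric in the first two arguments. -/
theorem koszul_sub_swap (S : ContactCalabiYau K) (X Y Z : ∀ y : K, T y) (x : K) :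
    S.koszul X Y Z x - S.koszul Y X Z x = 2 * S.gV x (bracket X Y x) (Z x) := by
  have h1 : bracket Y X x = -bracket X Y x := VectorField.mlieBracket_swap_apply
  have h2 : (fun y ↦ S.gV y (Y y) (X y)) = fun y ↦ S.gV y (X y) (Y y) :=
    funext fun y ↦ S.gV_symm y _ _
  simp only [koszul, h1, h2, map_neg, LinearMap.neg_apply]
  ring

/-- The torsion of `A` is `ω ⊗ ξ`: vertically it is `dη = ω`, and the transverse Levi-Civita
connection has no horizontal torsion. -/
theorem torsion_connA (S : ContactCalabiYau K) {x : K} {X Y : ∀ y : K, T y}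
    (hX : DiffFieldAt X x) (hY : DiffFieldAt Y x) :
    S.covA Y x (X x) - S.covA X x (Y x) - bracket X Y x = S.ω x (X x) (Y x) • S.ξ x := by
  refine eq_of_metric (S := S) fun Z₀ ↦ ?_
  obtain ⟨Z, hZ, rfl⟩ : ∃ Z : ∀ y : K, T y, DiffFieldAt Z x ∧ Z x = Z₀ :=
    ⟨FiberBundle.extend E7 Z₀, FiberBundle.mdifferentiableAt_extend .., by simp⟩
  have hk := S.koszul_sub_swap X Y (S.hor Z) x
  have hh : S.gV x (bracket X Y x) (S.hor Z x) = S.gV x (bracket X Y x) (Z x) := by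
    simp [hor, S.gV_ξ]
  rw [hh] at hk
  simp only [map_sub, LinearMap.sub_apply, metric_covA hX hY hZ, metric_covA hY hX hZ, map_smul,
    LinearMap.smul_apply, smul_eq_mul, S.dη_eq x X Y hX hY, metric_apply, pairA, S.η_ξ,
    S.gV_ξ_left]
  linear_combination (1 / 2) * hk

theorem metric_tensorB_sub_swap (S : ContactCalabiYau K) {ε : ℝ} (hε : 0 < ε) (x : K)
    (X Y Z : T x) :
    S.metric ε x (S.tensorB ε x X Y) Z - S.metric ε x (S.tensorB ε x Y X) Z
      = -2 * ε * (S.ω x X Y * S.η x Z) := by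
  have hε' := hε.ne'
  simp only [tensorB, metric_apply, map_add, map_smul, LinearMap.add_apply,
    LinearMap.smul_apply, smul_eq_mul, S.η_ξ, S.η_J, S.gV_ξ_left, gV_J_left, S.ω_swap x Y X]
  field_simp
  ring

theorem metric_tensorC (S : ContactCalabiYau K) {ε : ℝ} (hε : 0 < ε) (x : K) (X Y Z : T x) :
    S.metric ε x (S.tensorC hε x X Y) Z = ε⁻¹ * S.flux ε x X Y Z := by
  rw [tensorC, map_smul, LinearMap.smul_apply, metric_sharp, smul_eq_mul]
  rfl

theorem metric_tensorI (S : ContactCalabiYau K) (ε : ℝ) (x : K) (X Y Z : T x) :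
    S.metric ε x (S.tensorI ε x X Y) Z = ε * (S.η x X * S.ω x Y Z) := by
  simp only [tensorI, metric_apply, map_smul, LinearMap.smul_apply, smul_eq_mul, S.η_J, gV_J_left]
  ring

theorem flux_swap (S : ContactCalabiYau K) (ε : ℝ) (x : K) (X Y Z : T x) :
    S.flux ε x Y X Z = -S.flux ε x X Y Z := by
  simp only [flux, S.Ω_swap x X Y Z, S.ω_swap x Y X, S.ω_swap x X Z, S.ω_swap x Z Y,
    Complex.neg_re]
  ring

theorem flux_swap' (S : ContactCalabiYau K) (ε : ℝ) (x : K) (X Y Z : T x) :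
    S.flux ε x X Z Y = -S.flux ε x X Y Z := by
  rw [S.flux_cyclic ε x X Z Y, S.flux_cyclic ε x Z Y X, S.flux_swap]

theorem torsion_twistedConnection (S : ContactCalabiYau K) {ε : ℝ} (hε : 0 < ε) (δ k m : ℝ)
    (x : K) (X Y : T x) :
    (S.twistedConnection hε δ k m).torsion x X Y
      = S.ω x X Y • S.ξ x + (S.twistForm hε δ k m x Y X - S.twistForm hε δ k m x X Y) := by
  obtain ⟨X, hX, rfl⟩ : ∃ X' : ∀ y : K, T y, DiffFieldAt X' x ∧ X' x = X :=
    ⟨FiberBundle.extend E7 X, FiberBundle.mdifferentiableAt_extend .., by simp⟩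
  obtain ⟨Y, hY, rfl⟩ : ∃ Y' : ∀ y : K, T y, DiffFieldAt Y' x ∧ Y' x = Y :=
    ⟨FiberBundle.extend E7 Y, FiberBundle.mdifferentiableAt_extend .., by simp⟩
  rw [← S.torsion_connA hX hY, CovariantDerivative.torsion_apply _ hX hY]
  change (S.covA Y x (X x) + S.twistForm hε δ k m x (Y x) (X x))
    - (S.covA X x (Y x) + S.twistForm hε δ k m x (X x) (Y x)) - bracket X Y x = _
  abel

theorem metric_twistForm (S : ContactCalabiYau K) {ε : ℝ} (hε : 0 < ε) (δ k m : ℝ)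
    (x : K) (X Y Z : T x) :
    S.metric ε x (S.twistForm hε δ k m x Y X) Z
      = (k * ε / 2) * S.metric ε x (S.tensorB ε x X Y) Z
        + (k * ε * δ / 2) * (ε⁻¹ * S.flux ε x X Y Z)
        + (k * m * ε / 2) * (ε * (S.η x X * S.ω x Y Z)) := by
  change S.metric ε x ((k * ε / 2) • S.tensorB ε x X Y + (k * ε * δ / 2) • S.tensorC hε x X Y
    + (k * m * ε / 2) • S.tensorI ε x X Y) Z = _
  simp only [map_add, map_smul, LinearMap.add_apply, LinearMap.smul_apply, smul_eq_mul,
    metric_tensorC, metric_tensorI]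

theorem metric_torsion_twistedConnection (S : ContactCalabiYau K) {ε : ℝ} (hε : 0 < ε)
    (δ k m : ℝ) (x : K) (X Y Z : T x) :
    S.metric ε x ((S.twistedConnection hε δ k m).torsion x X Y) Z
      = ε ^ 2 * ((1 - k) * (S.ω x X Y * S.η x Z)
          + k * m / 2 * (S.η x X * S.ω x Y Z + S.η x Y * S.ω x Z X))
        + k * δ * S.flux ε x X Y Z := by
  have hB := S.metric_tensorB_sub_swap hε x X Y Z
  have hξ : S.metric ε x (S.ξ x) Z = ε ^ 2 * S.η x Z := by
    rw [metric_apply, S.η_ξ, S.gV_ξ_left]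
    ring
  rw [S.torsion_twistedConnection hε]
  simp only [map_add, map_sub, map_smul, LinearMap.add_apply, LinearMap.sub_apply,
    LinearMap.smul_apply, smul_eq_mul, S.metric_twistForm hε, hξ, S.flux_swap ε x X Y Z,
    S.ω_swap x X Z]
  linear_combination (k * ε / 2) * hB + k * δ * S.flux ε x X Y Z * mul_inv_cancel₀ hε.ne'

theorem exists_horizontal_ne_zero (S : ContactCalabiYau K) (x : K) :
    ∃ v : T x, S.η x v = 0 ∧ v ≠ 0 := by
  have hd : Module.finrank ℝ ℝ < Module.finrank ℝ (T x) := by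
    change _ < Module.finrank ℝ E7
    simp
  obtain ⟨v, hv, hv0⟩ := Submodule.exists_mem_ne_zero_of_ne_bot
    (LinearMap.ker_ne_bot_of_finrank_lt (f := (S.η x).toLinearMap) hd)
  exact ⟨v, hv, hv0⟩

end ContactCY.ContactCalabiYau

end

theorem mainTheorem7 {K : Type*} [TopologicalSpace K] [ChartedSpace ContactCY.E7 K]
    [IsManifold (𝓡 7) (⊤ : ℕ∞) K] [Nonempty K] (S : ContactCY.ContactCalabiYau K)
    {ε : ℝ} (hε : 0 < ε) (δ k m : ℝ) (hk : k ≠ 0) :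
    S.HasTotallySkewTorsion ε (S.twistedConnection hε δ k m) ↔ 1 - k * (1 + m / 2) = 0 := by
  constructor
  · intro h
    obtain ⟨x⟩ := ‹Nonempty K›
    obtain ⟨v, hv, hv0⟩ := S.exists_horizontal_ne_zero x
    have h2 := (h x v (S.J x v) (S.ξ x)).2.1
    have hpos := S.ω_J_pos x v hv hv0
    rw [S.metric_torsion_twistedConnection hε, S.metric_torsion_twistedConnection hε,
      S.flux_swap' ε x v (S.J x v) (S.ξ x)] at h2
    simp only [hv, S.η_ξ, S.η_J, S.ω_ξ, S.ω_swap x (S.J x v) v] at h2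
    have h3 : (ε ^ 2 * S.ω x v (S.J x v)) * (1 - k * (1 + m / 2)) = 0 := by
      linear_combination h2
    exact (mul_eq_zero.mp h3).resolve_left (by positivity)
  · intro h x X Y Z
    have hkm : k * m / 2 = 1 - k := by linear_combination -h
    have hf : S.flux ε x Z Y X = -S.flux ε x X Y Z := by
      rw [S.flux_swap ε x Y Z X, ← S.flux_cyclic ε x X Y Z]
    simp only [S.metric_torsion_twistedConnection hε, hkm, S.flux_swap ε x X Y Z,
      S.flux_swap' ε x X Y Z, hf, S.ω_swap x Y X, S.ω_swap x Z X, S.ω_swap x Z Y]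
    refine ⟨?_, ?_, ?_⟩ <;> ring
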